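/- Let $n\ge 3$ and let $A,B$ be real symmetric $n\times n$ matrices that are hypomorphic: for every $i\in\{1,\dots,n\}$, the matrix $B_i$ obtained from $B$ by deleting the $i$-th row and column arises from the corresponding matrix $A_i$ by some simultaneous permutation of rows and columns. Let $\mathbf 1=(1,\dots,1)^t\in\mathbb R^n$. For a real symmetric $n\times n$ matrix $C$, a diagonal matrix $D=\mathrm{diag}(\lambda_1\ge\cdots\ge\lambda_n)$, an orthogonal matrix $Q=(\mathbf q_1,\dots,\mathbf q_n)$ and a set $S\subseteq\{1,\dots,n\}$, call $C=QDQ^t$ a decomposition adapted to $S$ if $(\mathbf 1,\mathbf q_i)\ne 0$ for $i\in S$, $(\mathbf 1,\mathbf q_i)=0$ for $i\notin S$, and $|S|$ is the number of distinct eigenvalues of $C$ whose eigenspace is not orthogonal to $\mathbf 1$. 1. There exist a set $S\subseteq\{1,\dots,n\}$, a diagonal matrix $D$ and orthogonal matrices $P=(\mathbf p_1,\dots,\mathbf p_n)$, $U=(\mathbf u_1,\dots,\mathbf u_n)$ such that $A=PDP^t$ and $B=UDU^t$ are both decompositions adapted to $S$ and $\mathbf p_i=\mathbf u_i$ or $\mathbf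 p_i=-\mathbf u_i$ for every $i\in S$. 2. Moreover, whenever $A=PDP^t$ and $B=UDU^t$ (with the same $D$) are decompositions adapted to the same set $S$, we have $\mathbf p_i=\mathbf u_i$ or $\mathbf p_i=-\mathbf u_i$ for every $i\in S$. 3. In particular, if $\lambda$ is a simple eigenvalue of $A$ whose eigenspace is not orthogonal to $\mathbf 1$, then the $\lambda$-eigenspaces of $A$ and $B$ coincide. -/

import Mathlib

/-- The principal submatrix `A_i`: delete the `i`-th row and the `i`-th column of `A`. -/
def deleteRowCol {n : ℕ} (A : Matrix (Fin n) (Fin n) ℝ) (i : Fin n) :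
    Matrix {j : Fin n // j ≠ i} {j : Fin n // j ≠ i} ℝ :=
  A.submatrix Subtype.val Subtype.val

/-- `A` and `B` are hypomorphic: for every `i`, `B_i` is obtained from `A_i` by a simultaneous
permutation (depending on `i`) of rows and columns. -/
def Hypomorphic {n : ℕ} (A B : Matrix (Fin n) (Fin n) ℝ) : Prop :=
  ∀ i : Fin n, ∃ σ : Equiv.Perm {j : Fin n // j ≠ i},
    deleteRowCol B i = (deleteRowCol A i).submatrix σ σ

/-- The eigenspace of `A` for `μ` (zero if `μ` is not an eigenvalue). -/
noncomputable def eigenspaceOf {n : ℕ} (A : Matrix (Fin n) (Fin n) ℝ) (μ : ℝ) :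
    Submodule ℝ (Fin n → ℝ) :=
  Module.End.eigenspace (Matrix.toLin' A) μ

/-- The set of the eigenvalues of `A` whose eigenspace is not orthogonal to `x`. -/
def mainEigenvalues {n : ℕ} (A : Matrix (Fin n) (Fin n) ℝ) (x : Fin n → ℝ) : Set ℝ :=
  {μ | ∃ v ∈ eigenspaceOf A μ, x ⬝ᵥ v ≠ 0}

/-- `A = P D Pᵀ` with `P` orthogonal and `D = diag(d₁ ≥ ⋯ ≥ dₙ)`, where the columns of `P` not
orthogonal to `x` are exactly those indexed by `S`, and `S` has as many elements as `A` has distinct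
eigenvalues with eigenspace not orthogonal to `x`. -/
structure IsAdaptedDecomposition {n : ℕ} (A : Matrix (Fin n) (Fin n) ℝ) (x : Fin n → ℝ)
    (d : Fin n → ℝ) (P : Matrix (Fin n) (Fin n) ℝ) (S : Finset (Fin n)) : Prop where
  antitone : Antitone d
  orthogonal : P ∈ Matrix.orthogonalGroup (Fin n) ℝ
  eq_mul : A = P * Matrix.diagonal d * P.transpose
  card_eq : S.card = (mainEigenvalues A x).ncard
  mem : ∀ i ∈ S, x ⬝ᵥ P.col i ≠ 0
  not_mem : ∀ i, i ∉ S → x ⬝ᵥ P.col i = 0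

/-!
The characteristic polynomials of the principal submatrices `A_i` are the diagonal entries of
`adj(X - A)`, and they add up to the derivative of the characteristic polynomial `χ_A`. Hence
`χ_A = χ_B + c` for hypomorphic `A` and `B`. Subtracting the all-ones matrix `J = 𝟏𝟏ᵗ` preserves
hypomorphy, so also `χ_{A - J} = χ_{B - J} + e`. Since `J` has rank one, the vector
`v_A = adj(X - A) 𝟏` satisfies `χ_{A - J} = χ_A + 𝟏 ⬝ v_A` and
`(v_A)_i² = χ_{A - J} adj(X - A)_ii - χ_A adj(X - (A - J))_ii`.
So `((v_A)_i - (v_B)_i) ((v_A)_i + (v_B)_i)` has degree at most `n - 1`, the exact degree of the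
second factor, with leading coefficient `2`. Therefore `(v_A)_i - (v_B)_i` is a constant `a_i` with
`2 a_i = e - c`, while `∑ i, a_i = e - c`. If `n ≠ 2`, this forces `e = c` and `v_A = v_B`. If `c`
were nonzero, the product identity, whose left side now vanishes, would give `X - A` and
`X - (A - J)` the same adjugate diagonal, so `𝟏 ⬝ v_A = χ_{A - J} - χ_A` would be constant; but its
leading term is `n X ^ (n - 1)`. Hence `χ_A = χ_B`.

The recursion `A v_A = X v_A - χ_A 𝟏` now gives `q(A) 𝟏 = q(B) 𝟏` for every polynomial `q`.
Taking for `q` a Lagrange basis polynomial at the main eigenvalues, `q(A) 𝟏 = (𝟏, p_i) p_i` is the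
projection of `𝟏` onto a single eigenspace, and it determines the unit vector `p_i` up to sign.
-/

open Matrix Polynomial

section PerturbedAdjugate

variable {R m : Type*} [CommRing R] [Fintype m] [DecidableEq m]

theorem derivative_det (M : Matrix m m R[X]) :
    derivative M.det = (M.adjugate * M.map derivative).trace := by
  have htrace : (M.adjugate * M.map derivative).trace =
      ∑ i, (M.updateCol i fun j => derivative (M j i)).det := by
    refine Finset.sum_congr rfl fun i _ => ?_
    rw [← cramer_apply, cramer_eq_adjugate_mulVec]
    rfl
  rw [htrace, det_apply, derivative_sum]
  simp only [det_apply]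
  rw [Finset.sum_comm]
  refine Finset.sum_congr rfl fun σ _ => ?_
  rw [Units.smul_def, derivative_smul, derivative_prod_finset, Finset.smul_sum]
  refine Finset.sum_congr rfl fun i _ => ?_
  rw [Units.smul_def, ← Finset.mul_prod_erase Finset.univ _ (Finset.mem_univ i), mul_comm,
    updateCol_self]
  congr 2
  exact Finset.prod_congr rfl fun j hj => (updateCol_ne (Finset.ne_of_mem_erase hj)).symm

theorem derivative_charpoly (A : Matrix m m R) :
    derivative A.charpoly = A.charmatrix.adjugate.trace := by
  have hone : A.charmatrix.map derivative = 1 := by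
    ext i j : 2
    by_cases h : i = j <;> simp [charmatrix, h, Matrix.one_apply]
  rw [charpoly, derivative_det, hone, mul_one]

theorem adjugate_apply_self (N : Matrix m m R) (i : m) :
    N.adjugate i i = (N.submatrix (Subtype.val : {j // j ≠ i} → m) Subtype.val).det := by
  rw [adjugate_apply, twoBlockTriangular_det _ (· ≠ i)]
  · have hminor : (N.updateRow i (Pi.single i 1)).toSquareBlockProp (· ≠ i) =
        N.submatrix Subtype.val Subtype.val :=
      Matrix.ext fun j k => congrFun (updateRow_ne j.2) k.1
    have hcorner : (N.updateRow i (Pi.single i 1)).toSquareBlockProp (fun j => ¬j ≠ i) = 1 := by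
      ext ⟨j, hj⟩ ⟨k, hk⟩
      obtain rfl := not_not.mp hj
      obtain rfl := not_not.mp hk
      simp [toSquareBlockProp]
    rw [hminor, hcorner, det_one, mul_one]
  · intro j hj k hk
    rw [not_not.mp hj, updateRow_self, Pi.single_eq_of_ne hk]

theorem charmatrix_submatrix {l : Type*} [Fintype l] [DecidableEq l] (A : Matrix m m R)
    {f : l → m} (hf : f.Injective) :
    (A.submatrix f f).charmatrix = A.charmatrix.submatrix f f := by
  ext i j : 2
  simp [charmatrix, diagonal_apply, hf.eq_iff]

theorem adjugate_add_vecMulVec_mulVec (N : Matrix m m R) (u w : m → R) :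
    (N + vecMulVec u w).adjugate *ᵥ u = N.adjugate *ᵥ u := by
  ext i
  rw [← cramer_eq_adjugate_mulVec, ← cramer_eq_adjugate_mulVec, cramer_apply, cramer_apply,
    ← det_transpose, ← det_transpose (N.updateCol i u)]
  refine det_eq_of_forall_row_eq_smul_add_const (fun j => if j = i then 0 else w j) i (by simp) ?_
  intro j k
  by_cases h : j = i
  · simp [h]
  · simp [h, vecMulVec_apply, mul_comm]

theorem vecMul_adjugate_add_vecMulVec (N : Matrix m m R) (u w : m → R) :
    w ᵥ* (N + vecMulVec u w).adjugate = w ᵥ* N.adjugate := by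
  rw [← mulVec_transpose, ← mulVec_transpose, adjugate_transpose, adjugate_transpose,
    transpose_add, transpose_vecMulVec, adjugate_add_vecMulVec_mulVec]

theorem det_add_vecMulVec (N : Matrix m m R) (u w : m → R) :
    (N + vecMulVec u w).det = N.det + w ⬝ᵥ (N.adjugate *ᵥ u) := by
  induction w using Pi.single_induction generalizing N with
  | zero => simp
  | add v w hv hw =>
    rw [vecMulVec_add, ← add_assoc, hw, hv, adjugate_add_vecMulVec_mulVec, add_dotProduct,
      add_assoc]
  | single i a =>
    have hcol : N + vecMulVec u (Pi.single i a) = N.updateCol i (N.col i + a • u) := by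
      ext j k
      by_cases hk : k = i
      · subst hk
        simp [vecMulVec_apply, mul_comm]
      · simp [vecMulVec_apply, hk]
    have hself : N.updateCol i (N.col i) = N := updateCol_eq_self N i
    rw [hcol, det_updateCol_add, det_updateCol_smul, hself, ← cramer_apply,
      cramer_eq_adjugate_mulVec, single_dotProduct]

theorem adjugate_mul_mul_adjugate_add (N E : Matrix m m R) :
    N.adjugate * E * (N + E).adjugate = (N + E).det • N.adjugate - N.det • (N + E).adjugate := by
  have h : N.adjugate * (N + E) * (N + E).adjugate = (N + E).det • N.adjugate := by
    rw [mul_assoc, mul_adjugate, mul_smul_comm, mul_one]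
  rw [← h, mul_add, add_mul, adjugate_mul, smul_mul_assoc, one_mul, add_sub_cancel_left]

theorem sq_adjugate_mulVec {N : Matrix m m R} (hN : N.IsSymm) (u : m → R) (i : m) :
    (N.adjugate *ᵥ u) i ^ 2 = (N + vecMulVec u u).det * N.adjugate i i -
      N.det * (N + vecMulVec u u).adjugate i i := by
  have h := congrFun₂ (adjugate_mul_mul_adjugate_add N (vecMulVec u u)) i i
  have hadj : u ᵥ* N.adjugate = N.adjugate *ᵥ u := by
    rw [← mulVec_transpose, hN.adjugate]
  rw [mul_vecMulVec, vecMulVec_mul, vecMul_adjugate_add_vecMulVec, hadj, vecMulVec_apply] at h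
  rw [pow_two, h]
  rfl

end PerturbedAdjugate

section ResolventNumerator

variable {R m : Type*} [CommRing R] [Fintype m] [DecidableEq m]

theorem X_sub_C_mul_matPolyEquiv_adjugate_charmatrix (A : Matrix m m R) :
    (X - C A) * matPolyEquiv A.charmatrix.adjugate =
      A.charpoly.map (algebraMap R (Matrix m m R)) := by
  rw [← matPolyEquiv_charmatrix, ← map_mul, mul_adjugate, ← charpoly, matPolyEquiv_smul_one]

theorem monic_matPolyEquiv_adjugate_charmatrix (A : Matrix m m R) :
    (matPolyEquiv A.charmatrix.adjugate).Monic := by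
  refine (monic_X_sub_C A).of_mul_monic_left ?_
  rw [X_sub_C_mul_matPolyEquiv_adjugate_charmatrix]
  exact A.charpoly_monic.map _

theorem natDegree_matPolyEquiv_adjugate_charmatrix [Nontrivial R] (A : Matrix m m R) :
    (matPolyEquiv A.charmatrix.adjugate).natDegree = Fintype.card m - 1 := by
  cases isEmpty_or_nonempty m with
  | inl _ => simp [Subsingleton.elim A.charmatrix.adjugate 0]
  | inr _ =>
    have h := congrArg natDegree (X_sub_C_mul_matPolyEquiv_adjugate_charmatrix A)
    rw [(monic_X_sub_C A).natDegree_mul (monic_matPolyEquiv_adjugate_charmatrix A),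
      natDegree_X_sub_C, A.charpoly_monic.natDegree_map, charpoly_natDegree_eq_dim] at h
    omega

theorem coeff_adjugate_charmatrix (A : Matrix m m R) (i j : m) :
    (A.charmatrix.adjugate i j).coeff (Fintype.card m - 1) = (1 : Matrix m m R) i j := by
  nontriviality R
  rw [← matPolyEquiv_coeff_apply, ← natDegree_matPolyEquiv_adjugate_charmatrix A,
    (monic_matPolyEquiv_adjugate_charmatrix A).coeff_natDegree]

theorem natDegree_adjugate_charmatrix_le (A : Matrix m m R) (i j : m) :
    (A.charmatrix.adjugate i j).natDegree ≤ Fintype.card m - 1 := by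
  nontriviality R
  refine natDegree_le_iff_coeff_eq_zero.mpr fun k hk => ?_
  rw [← matPolyEquiv_coeff_apply, coeff_eq_zero_of_natDegree_lt, Matrix.zero_apply]
  rwa [natDegree_matPolyEquiv_adjugate_charmatrix]

/-- The polynomial vector `adj(X - A) x`: the numerator of `(X - A)⁻¹ x` over the common
denominator `A.charpoly`. -/
noncomputable def resolventNumerator (A : Matrix m m R) (x : m → R) : m → R[X] :=
  A.charmatrix.adjugate *ᵥ (C ∘ x)

theorem charmatrix_mulVec_resolventNumerator (A : Matrix m m R) (x : m → R) :
    A.charmatrix *ᵥ resolventNumerator A x = A.charpoly • (C ∘ x) := by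
  rw [resolventNumerator, mulVec_mulVec, mul_adjugate, smul_mulVec, one_mulVec, charpoly]

theorem map_C_mulVec_resolventNumerator (A : Matrix m m R) (x : m → R) :
    A.map C *ᵥ resolventNumerator A x =
      (X : R[X]) • resolventNumerator A x - A.charpoly • (C ∘ x) := by
  rw [← charmatrix_mulVec_resolventNumerator, charmatrix, sub_mulVec, scalar_apply,
    ← smul_one_eq_diagonal, smul_mulVec, one_mulVec, sub_sub_cancel]
  rfl

theorem coeff_resolventNumerator (A : Matrix m m R) (x : m → R) (i : m) :
    (resolventNumerator A x i).coeff (Fintype.card m - 1) = x i := by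
  simp [resolventNumerator, mulVec, dotProduct, finsetSum_coeff, coeff_adjugate_charmatrix,
    one_apply]

theorem coeff_map_C_mulVec_resolventNumerator (A N : Matrix m m R) (x : m → R) (i : m) :
    ((N.map C *ᵥ resolventNumerator A x) i).coeff (Fintype.card m - 1) = (N *ᵥ x) i := by
  simp [mulVec, dotProduct, finsetSum_coeff, coeff_resolventNumerator]

theorem map_C_pow_succ_mulVec_resolventNumerator (A : Matrix m m R) (x : m → R) (k : ℕ) :
    (A ^ (k + 1)).map C *ᵥ resolventNumerator A x =
      (X : R[X]) • ((A ^ k).map C *ᵥ resolventNumerator A x) -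
        A.charpoly • (C ∘ (A ^ k *ᵥ x)) := by
  have hC : C ∘ (A ^ k *ᵥ x) = (A ^ k).map C *ᵥ (C ∘ x) :=
    funext fun i => RingHom.map_mulVec C _ _ i
  rw [pow_succ, Matrix.map_mul, ← mulVec_mulVec, map_C_mulVec_resolventNumerator, mulVec_sub,
    mulVec_smul, mulVec_smul, hC]

theorem pow_mulVec_eq_of_resolventNumerator_eq {A B : Matrix m m R} {x : m → R}
    (hp : A.charpoly = B.charpoly) (hv : resolventNumerator A x = resolventNumerator B x) (k : ℕ) :
    A ^ k *ᵥ x = B ^ k *ᵥ x := by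
  have hpow {j : ℕ} (h : (A ^ j).map C *ᵥ resolventNumerator A x =
      (B ^ j).map C *ᵥ resolventNumerator B x) : A ^ j *ᵥ x = B ^ j *ᵥ x := by
    ext i
    rw [← coeff_map_C_mulVec_resolventNumerator A, h, coeff_map_C_mulVec_resolventNumerator]
  refine hpow ?_
  induction k with
  | zero => simpa using hv
  | succ k ih =>
    rw [map_C_pow_succ_mulVec_resolventNumerator, map_C_pow_succ_mulVec_resolventNumerator, ih,
      hpow ih, hp]

theorem aeval_mulVec_eq_of_resolventNumerator_eq {A B : Matrix m m R} {x : m → R}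
    (hp : A.charpoly = B.charpoly) (hv : resolventNumerator A x = resolventNumerator B x)
    (q : R[X]) : aeval A q *ᵥ x = aeval B q *ᵥ x := by
  simp only [aeval_eq_sum_range, sum_mulVec, smul_mulVec,
    pow_mulVec_eq_of_resolventNumerator_eq hp hv]

theorem charmatrix_sub_vecMulVec (A : Matrix m m R) (u w : m → R) :
    (A - vecMulVec u w).charmatrix = A.charmatrix + vecMulVec (C ∘ u) (C ∘ w) := by
  ext i j : 2
  simp only [charmatrix_apply, Matrix.sub_apply, Matrix.add_apply, vecMulVec_apply,
    Function.comp_apply, C_sub, C_mul, sub_sub_eq_add_sub, sub_add_eq_add_sub]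

theorem charpoly_sub_vecMulVec (A : Matrix m m R) (u w : m → R) :
    (A - vecMulVec u w).charpoly = A.charpoly + (C ∘ w) ⬝ᵥ resolventNumerator A u := by
  rw [charpoly, charmatrix_sub_vecMulVec, det_add_vecMulVec, charpoly, resolventNumerator]

theorem sq_resolventNumerator {A : Matrix m m R} (hA : A.IsSymm) (x : m → R) (i : m) :
    resolventNumerator A x i ^ 2 =
      (A - vecMulVec x x).charpoly * A.charmatrix.adjugate i i -
        A.charpoly * (A - vecMulVec x x).charmatrix.adjugate i i := by
  have hsymm : A.charmatrix.IsSymm := by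
    rw [IsSymm, ← charmatrix_transpose, hA]
  rw [resolventNumerator, sq_adjugate_mulVec hsymm, ← charmatrix_sub_vecMulVec, ← charpoly,
    ← charpoly]

theorem sub_mul_add_resolventNumerator {A B : Matrix m m R} {x : m → R}
    (hA : A.IsSymm) (hB : B.IsSymm)
    (hdiag : A.charmatrix.adjugate.diag = B.charmatrix.adjugate.diag)
    (hdiag' : (A - vecMulVec x x).charmatrix.adjugate.diag =
      (B - vecMulVec x x).charmatrix.adjugate.diag)
    {c e : R} (hc : A.charpoly = B.charpoly + C c)
    (he : (A - vecMulVec x x).charpoly = (B - vecMulVec x x).charpoly + C e) (i : m) :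
    (resolventNumerator A x i - resolventNumerator B x i) *
        (resolventNumerator A x i + resolventNumerator B x i) =
      C e * A.charmatrix.adjugate i i - C c * (A - vecMulVec x x).charmatrix.adjugate i i := by
  have hsqA := sq_resolventNumerator hA x i
  have hsqB := sq_resolventNumerator hB x i
  simp only [← diag_apply, ← hdiag, ← hdiag'] at hsqA hsqB ⊢
  rw [hc, he] at hsqA
  linear_combination hsqA - hsqB

end ResolventNumerator

section DeterminedByDiagonals

theorem exists_eq_C_of_natDegree_mul_le {R : Type*} [Semiring R] [NoZeroDivisors R] {p q : R[X]}
    {k : ℕ} (h : (p * q).natDegree ≤ k) (hq : q.coeff k ≠ 0) : ∃ a, p = C a := by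
  rcases eq_or_ne p 0 with rfl | hp
  · exact ⟨0, C_0.symm⟩
  · have hq0 : q ≠ 0 := fun h0 => hq (by rw [h0, coeff_zero])
    have hk := le_natDegree_of_ne_zero hq
    rw [natDegree_mul hp hq0] at h
    exact ⟨_, eq_C_of_natDegree_eq_zero (by omega)⟩

variable {R m : Type*} [CommRing R] [Fintype m] [DecidableEq m] {A B : Matrix m m R}
  {x : m → R}

theorem exists_charpoly_eq_add_C [IsAddTorsionFree R]
    (h : A.charmatrix.adjugate.diag = B.charmatrix.adjugate.diag) :
    ∃ c, A.charpoly = B.charpoly + C c := by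
  have hder : derivative (A.charpoly - B.charpoly) = 0 := by
    rw [derivative_sub, derivative_charpoly, derivative_charpoly, trace, h, trace, sub_self]
  exact ⟨_, eq_add_of_sub_eq' (eq_C_of_derivative_eq_zero hder)⟩

variable [IsDomain R] [CharZero R]

theorem exists_resolventNumerator_sub_eq_C (hA : A.IsSymm) (hB : B.IsSymm)
    (hdiag : A.charmatrix.adjugate.diag = B.charmatrix.adjugate.diag)
    (hdiag' : (A - vecMulVec x x).charmatrix.adjugate.diag =
      (B - vecMulVec x x).charmatrix.adjugate.diag)
    {c e : R} (hc : A.charpoly = B.charpoly + C c)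
    (he : (A - vecMulVec x x).charpoly = (B - vecMulVec x x).charpoly + C e)
    {i : m} (hx : x i ≠ 0) :
    ∃ a, resolventNumerator A x i - resolventNumerator B x i = C a ∧ 2 * x i * a = e - c := by
  have hmul := sub_mul_add_resolventNumerator hA hB hdiag hdiag' hc he i
  have hcoeff : (resolventNumerator A x i + resolventNumerator B x i).coeff
      (Fintype.card m - 1) = 2 * x i := by
    rw [coeff_add, coeff_resolventNumerator, coeff_resolventNumerator, two_mul]
  have hdeg : (C e * A.charmatrix.adjugate i i -
      C c * (A - vecMulVec x x).charmatrix.adjugate i i).natDegree ≤ Fintype.card m - 1 :=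
    (natDegree_sub_le _ _).trans (max_le
      ((natDegree_C_mul_le _ _).trans (natDegree_adjugate_charmatrix_le _ i i))
      ((natDegree_C_mul_le _ _).trans (natDegree_adjugate_charmatrix_le _ i i)))
  obtain ⟨a, ha⟩ := exists_eq_C_of_natDegree_mul_le (hmul ▸ hdeg)
    (hcoeff ▸ mul_ne_zero two_ne_zero hx)
  refine ⟨a, ha, ?_⟩
  have htop := congrArg (fun p => p.coeff (Fintype.card m - 1)) hmul
  simp only [ha, coeff_C_mul, coeff_sub, hcoeff, coeff_adjugate_charmatrix, one_apply_eq,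
    mul_one] at htop
  rw [mul_comm, htop]

theorem resolventNumerator_eq_of_diag_eq (hm : Fintype.card m ≠ 2) (hA : A.IsSymm) (hB : B.IsSymm)
    (hdiag : A.charmatrix.adjugate.diag = B.charmatrix.adjugate.diag)
    (hdiag' : (A - vecMulVec x x).charmatrix.adjugate.diag =
      (B - vecMulVec x x).charmatrix.adjugate.diag)
    (hx : ∀ i, x i ≠ 0) : resolventNumerator A x = resolventNumerator B x := by
  obtain ⟨c, hc⟩ := exists_charpoly_eq_add_C hdiag
  obtain ⟨e, he⟩ := exists_charpoly_eq_add_C hdiag'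
  choose a ha hxa using fun i =>
    exists_resolventNumerator_sub_eq_C hA hB hdiag hdiag' hc he (hx i)
  have hsum : ∑ i, x i * a i = e - c := by
    have hdot : (C ∘ x) ⬝ᵥ (resolventNumerator A x - resolventNumerator B x) = C (e - c) := by
      rw [charpoly_sub_vecMulVec, charpoly_sub_vecMulVec, hc] at he
      rw [dotProduct_sub, C_sub]
      linear_combination he
    apply C_injective
    rw [← hdot, map_sum]
    exact Finset.sum_congr rfl fun i _ => by rw [C_mul, Pi.sub_apply, ha, Function.comp_apply]
  have hec : e - c = 0 := by
    have hcount : (Fintype.card m : R) * (e - c) = 2 * (e - c) := by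
      nth_rewrite 2 [← hsum]
      rw [Finset.mul_sum, ← nsmul_eq_mul, ← Finset.card_univ, ← Finset.sum_const]
      exact Finset.sum_congr rfl fun i _ => by rw [← hxa i, mul_assoc]
    by_contra hne
    exact hm (by exact_mod_cast mul_right_cancel₀ hne hcount)
  ext1 i
  have hai : a i = 0 := by
    have h := hxa i
    rw [hec] at h
    exact (mul_eq_zero.mp h).resolve_left (mul_ne_zero two_ne_zero (hx i))
  rw [← sub_eq_zero, ha, hai, C_0]

theorem charpoly_eq_of_diag_eq [Nontrivial m] (hA : A.IsSymm) (hB : B.IsSymm)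
    (hdiag : A.charmatrix.adjugate.diag = B.charmatrix.adjugate.diag)
    (hdiag' : (A - vecMulVec x x).charmatrix.adjugate.diag =
      (B - vecMulVec x x).charmatrix.adjugate.diag)
    (hx : x ⬝ᵥ x ≠ 0) (hv : resolventNumerator A x = resolventNumerator B x) :
    A.charpoly = B.charpoly := by
  obtain ⟨c, hc⟩ := exists_charpoly_eq_add_C hdiag
  by_contra hne
  have hc0 : C c ≠ 0 := fun h0 => hne (by rw [hc, h0, add_zero])
  have he : (A - vecMulVec x x).charpoly = (B - vecMulVec x x).charpoly + C c := by
    rw [charpoly_sub_vecMulVec, charpoly_sub_vecMulVec, hv, hc, add_right_comm]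
  have hself : (A - vecMulVec x x).charmatrix.adjugate.diag = A.charmatrix.adjugate.diag := by
    ext1 i
    have hmul := sub_mul_add_resolventNumerator hA hB hdiag hdiag' hc he i
    rw [hv, sub_self, zero_mul, ← mul_sub, zero_eq_mul] at hmul
    exact (sub_eq_zero.mp (hmul.resolve_left hc0)).symm
  obtain ⟨b, hb⟩ := exists_charpoly_eq_add_C hself
  rw [charpoly_sub_vecMulVec, add_right_inj] at hb
  have hcard := Fintype.one_lt_card (α := m)
  have htop := congrArg (fun p => p.coeff (Fintype.card m - 1)) hb
  rw [coeff_C_of_ne_zero (by omega)] at htop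
  refine hx ?_
  rw [← htop]
  simp [dotProduct, finsetSum_coeff, coeff_resolventNumerator]

end DeterminedByDiagonals

namespace Hypomorphic

variable {n : ℕ} {A B : Matrix (Fin n) (Fin n) ℝ}

theorem sub_vecMulVec_one (h : Hypomorphic A B) :
    Hypomorphic (A - vecMulVec 1 1) (B - vecMulVec 1 1) := by
  intro i
  obtain ⟨σ, hσ⟩ := h i
  refine ⟨σ, Matrix.ext fun j k => ?_⟩
  have hjk : B j k = A (σ j) (σ k) := congrFun₂ hσ j k
  simp [deleteRowCol, hjk]

theorem diag_adjugate_charmatrix_eq (h : Hypomorphic A B) :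
    A.charmatrix.adjugate.diag = B.charmatrix.adjugate.diag := by
  have hadj (M : Matrix (Fin n) (Fin n) ℝ) (i : Fin n) :
      M.charmatrix.adjugate i i = (deleteRowCol M i).charpoly := by
    rw [adjugate_apply_self, charpoly, deleteRowCol, charmatrix_submatrix _ Subtype.val_injective]
  ext1 i
  obtain ⟨σ, hσ⟩ := h i
  rw [diag_apply, diag_apply, hadj, hadj, hσ]
  exact (charpoly_reindex σ.symm _).symm

theorem resolventNumerator_one_eq (hn : n ≠ 2) (hA : A.IsSymm) (hB : B.IsSymm)
    (h : Hypomorphic A B) : resolventNumerator A 1 = resolventNumerator B 1 :=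
  resolventNumerator_eq_of_diag_eq (by simpa using hn) hA hB h.diag_adjugate_charmatrix_eq
    h.sub_vecMulVec_one.diag_adjugate_charmatrix_eq fun _ => one_ne_zero

theorem charpoly_eq (hn : 3 ≤ n) (hA : A.IsSymm) (hB : B.IsSymm) (h : Hypomorphic A B) :
    A.charpoly = B.charpoly := by
  have : Nontrivial (Fin n) := Fin.nontrivial_iff_two_le.mpr (by omega)
  refine charpoly_eq_of_diag_eq hA hB h.diag_adjugate_charmatrix_eq
    h.sub_vecMulVec_one.diag_adjugate_charmatrix_eq ?_
    (h.resolventNumerator_one_eq (by omega) hA hB)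
  rw [one_dotProduct_one, Fintype.card_fin]
  exact_mod_cast (by omega : n ≠ 0)

theorem aeval_mulVec_one_eq (hn : 3 ≤ n) (hA : A.IsSymm) (hB : B.IsSymm) (h : Hypomorphic A B)
    (q : ℝ[X]) : aeval A q *ᵥ 1 = aeval B q *ᵥ 1 :=
  aeval_mulVec_eq_of_resolventNumerator_eq (h.charpoly_eq hn hA hB)
    (h.resolventNumerator_one_eq (by omega) hA hB) q

end Hypomorphic

section SymmetricOperator

open Module.End

variable {𝕜 E ι : Type*} [RCLike 𝕜] [NormedAddCommGroup E] [InnerProductSpace 𝕜 E]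
  {T : E →ₗ[𝕜] E} {d : ι → 𝕜} {s : Set ι}

theorem orthonormal_domRestrict_of_mem_eigenspace (hT : T.IsSymmetric) (hd : s.InjOn d)
    {v : ι → E} (hv : ∀ i ∈ s, v i ∈ eigenspace T (d i)) (hnorm : ∀ i ∈ s, ‖v i‖ = 1) :
    Orthonormal 𝕜 (s.domRestrict v) :=
  ⟨fun i => hnorm i i.2, fun i j hij => hT.orthogonalFamily_eigenspaces
    (hd.injective.ne hij) ⟨v i, hv i i.2⟩ ⟨v j, hv j j.2⟩⟩

variable [FiniteDimensional 𝕜 E] [Fintype ι] [DecidableEq 𝕜]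

theorem exists_orthonormalBasis_collected_eigenspaces (hT : T.IsSymmetric)
    (b : ∀ μ, OrthonormalBasis {i // d i = μ} 𝕜 (eigenspace T μ)) :
    ∃ b' : OrthonormalBasis ι 𝕜 E, ∀ i, b' i = b (d i) ⟨i, rfl⟩ := by
  have hon : Orthonormal 𝕜 fun i => (b (d i) ⟨i, rfl⟩ : E) :=
    (hT.orthogonalFamily_eigenspaces.orthonormal_sigma_orthonormal
      fun μ => (b μ).orthonormal).comp _ (Equiv.sigmaFiberEquiv d).symm.injective
  have hspan : ⊤ ≤ Submodule.span 𝕜 (Set.range fun i => (b (d i) ⟨i, rfl⟩ : E)) := by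
    rw [← Submodule.orthogonal_eq_bot_iff.mp hT.orthogonalComplement_iSup_eigenspaces_eq_bot]
    refine iSup_le fun μ => ?_
    have hμ := congrArg (Submodule.map (eigenspace T μ).subtype) (b μ).toBasis.span_eq
    rw [Submodule.map_span, Submodule.map_subtype_top] at hμ
    rw [← hμ, Submodule.span_le]
    rintro _ ⟨_, ⟨⟨i, rfl⟩, rfl⟩, rfl⟩
    exact Submodule.subset_span ⟨i, by simp⟩
  exact ⟨.mk hon hspan, fun i => by rw [OrthonormalBasis.coe_mk]⟩

theorem exists_orthonormalBasis_eigenspace_extension (hT : T.IsSymmetric)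
    (hd : ∀ μ, Finset.card {i | d i = μ} = Module.finrank 𝕜 (eigenspace T μ))
    {v : ι → E} (hv : ∀ i ∈ s, v i ∈ eigenspace T (d i)) (hvs : Orthonormal 𝕜 (s.domRestrict v)) :
    ∃ b : OrthonormalBasis ι 𝕜 E, (∀ i, b i ∈ eigenspace T (d i)) ∧ ∀ i ∈ s, b i = v i := by
  classical
  have hbasis (μ : 𝕜) : ∃ b : OrthonormalBasis {i // d i = μ} 𝕜 (eigenspace T μ),
      ∀ i : {i // d i = μ}, i.1 ∈ s → (b i : E) = v i := by
    have hcard : Module.finrank 𝕜 (eigenspace T μ) = Fintype.card {i // d i = μ} := by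
      rw [← hd, Fintype.card_subtype]
    let w (i : {i // d i = μ}) : eigenspace T μ :=
      if h : i.1 ∈ s then ⟨v i, by simpa only [i.2] using hv i h⟩ else 0
    have hw (i : {i // d i = μ}) (h : i.1 ∈ s) : (w i : E) = v i := by simp [w, h]
    have hon : Orthonormal 𝕜 ((Subtype.val ⁻¹' s).domRestrict w) := by
      rw [← (eigenspace T μ).subtypeₗᵢ.orthonormal_comp_iff]
      let f (i : (Subtype.val ⁻¹' s : Set {i // d i = μ})) : s := ⟨i, i.2⟩
      have hf : f.Injective := fun i j h => Subtype.ext (Subtype.ext (Subtype.mk.inj h))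
      convert hvs.comp f hf using 1
      exact funext fun i => hw i i.2
    obtain ⟨b, hb⟩ := hon.exists_orthonormalBasis_extension_of_card_eq hcard
    exact ⟨b, fun i hi => (congrArg Subtype.val (hb i hi)).trans (hw i hi)⟩
  choose b hb using hbasis
  obtain ⟨b', hb'⟩ := exists_orthonormalBasis_collected_eigenspaces hT b
  exact ⟨b', fun i => hb' i ▸ (b (d i) ⟨i, rfl⟩).2, fun i hi => (hb' i).trans (hb _ _ hi)⟩

theorem exists_orthonormalBasis_eigenspace_inner_ne_zero_iff (hT : T.IsSymmetric)
    (hd : ∀ μ, Finset.card {i | d i = μ} = Module.finrank 𝕜 (eigenspace T μ)) {x : E}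
    (hs : Set.BijOn d s {μ | ∃ v ∈ eigenspace T μ, inner 𝕜 x v ≠ 0}) :
    ∃ b : OrthonormalBasis ι 𝕜 E, (∀ i, b i ∈ eigenspace T (d i)) ∧
      ∀ i, inner 𝕜 x (b i) ≠ 0 ↔ i ∈ s := by
  -- In each eigenspace not orthogonal to `x`, take the normalized projection of `x` first.
  let p (μ : 𝕜) : E := (eigenspace T μ).starProjection x
  have hpmem (μ : 𝕜) : p μ ∈ eigenspace T μ := Submodule.starProjection_apply_mem _ x
  have hp {μ : 𝕜} {v : E} (hv : v ∈ eigenspace T μ) : inner 𝕜 (p μ) v = inner 𝕜 x v := by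
    rw [Submodule.inner_starProjection_left_eq_right, Submodule.starProjection_eq_self_iff.mpr hv]
  have hp0 {i : ι} (hi : i ∈ s) : p (d i) ≠ 0 := by
    obtain ⟨v, hv, hxv⟩ := hs.mapsTo hi
    contrapose hxv
    rw [← hp hv, hxv, inner_zero_left]
  let v (i : ι) : E := (‖p (d i)‖⁻¹ : 𝕜) • p (d i)
  have hv (i : ι) : v i ∈ eigenspace T (d i) := Submodule.smul_mem _ _ (hpmem _)
  obtain ⟨b, hb, hbv⟩ := exists_orthonormalBasis_eigenspace_extension hT hd (fun i _ => hv i)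
    (orthonormal_domRestrict_of_mem_eigenspace hT hs.injOn (fun i _ => hv i)
      fun i hi => norm_smul_inv_norm (hp0 hi))
  refine ⟨b, hb, fun i => ⟨fun hi => ?_, fun hi => ?_⟩⟩
  · obtain ⟨j, hj, hji⟩ := hs.surjOn ⟨b i, hb i, hi⟩
    have hpi : p (d i) = (‖p (d j)‖ : 𝕜) • b j := by
      rw [hbv j hj, smul_inv_smul₀ (by simpa using hp0 hj), hji]
    contrapose hi
    have hne : j ≠ i := fun h => hi (h ▸ hj)
    rw [← hp (hb i), hpi, inner_smul_left, b.inner_eq_zero hne, mul_zero]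
  · rw [← hp (hb i), hbv i hi, inner_smul_right]
    simpa using hp0 hi

end SymmetricOperator

section EigenspaceOf

variable {n : ℕ} {A : Matrix (Fin n) (Fin n) ℝ} {μ : ℝ} {v : Fin n → ℝ}

theorem mem_eigenspaceOf_iff : v ∈ eigenspaceOf A μ ↔ A *ᵥ v = μ • v :=
  Module.End.mem_eigenspace_iff

theorem aeval_mulVec_of_mem_eigenspaceOf (hv : v ∈ eigenspaceOf A μ) (q : ℝ[X]) :
    aeval A q *ᵥ v = q.eval μ • v := by
  have hq : aeval (toLin' A) q = toLin' (aeval A q) :=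
    aeval_algHom_apply (toLinAlgEquiv' (R := ℝ)) A q
  rw [← toLin'_apply, ← hq,
    Module.End.aeval_apply_of_mem_apply_eq_smul (Module.End.mem_eigenspace_iff.mp hv)]

theorem toLp_mem_eigenspace_toEuclideanLin_iff :
    WithLp.toLp 2 v ∈ Module.End.eigenspace (toEuclideanLin A) μ ↔ v ∈ eigenspaceOf A μ := by
  rw [mem_eigenspaceOf_iff, Module.End.mem_eigenspace_iff, toLpLin_toLp, toLin'_apply,
    ← WithLp.toLp_smul, (WithLp.toLp_injective 2).eq_iff]

theorem finrank_eigenspace_toEuclideanLin (A : Matrix (Fin n) (Fin n) ℝ) (μ : ℝ) :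
    Module.finrank ℝ (Module.End.eigenspace (toEuclideanLin A) μ) =
      Module.finrank ℝ (eigenspaceOf A μ) := by
  have hmap : Module.End.eigenspace (toEuclideanLin A) μ =
      (eigenspaceOf A μ).map (WithLp.linearEquiv 2 ℝ (Fin n → ℝ)).symm.toLinearMap := by
    ext v
    rw [Submodule.mem_map_equiv]
    exact toLp_mem_eigenspace_toEuclideanLin_iff
  rw [hmap, LinearEquiv.finrank_map_eq]

theorem finrank_eigenspaceOf (hA : A.IsSymm) (μ : ℝ) :
    Module.finrank ℝ (eigenspaceOf A μ) = A.charpoly.rootMultiplicity μ := by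
  have hT := isSymmetric_toEuclideanLin_iff.mpr (isHermitian_iff_isSymm.mpr hA)
  have hcharpoly : (toEuclideanLin A).charpoly = A.charpoly := by
    rw [toEuclideanLin, toLpLin_eq_toLin, charpoly_toLin]
  rw [← finrank_eigenspace_toEuclideanLin, ← hcharpoly, ← LinearMap.finrank_maxGenEigenspace_eq,
    hT.isFinitelySemisimple.maxGenEigenspace_eq_eigenspace]

theorem exists_antitone_card_eq_finrank_eigenspaceOf (hA : A.IsSymm) :
    ∃ d : Fin n → ℝ, Antitone d ∧
      ∀ μ, Finset.card {i | d i = μ} = Module.finrank ℝ (eigenspaceOf A μ) := by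
  have hT := isSymmetric_toEuclideanLin_iff.mpr (isHermitian_iff_isSymm.mpr hA)
  refine ⟨hT.eigenvalues finrank_euclideanSpace_fin, hT.eigenvalues_antitone _, fun μ => ?_⟩
  rw [← finrank_eigenspace_toEuclideanLin, ← hT.card_filter_eigenvalues_eq]
  rfl

theorem mainEigenvalues_eq_inner_ne_zero (A : Matrix (Fin n) (Fin n) ℝ) (x : Fin n → ℝ) :
    mainEigenvalues A x = {μ | ∃ v ∈ Module.End.eigenspace (toEuclideanLin A) μ,
      inner ℝ (WithLp.toLp 2 x) v ≠ 0} := by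
  refine Set.ext fun μ => ((WithLp.equiv 2 (Fin n → ℝ)).symm.exists_congr fun v => ?_)
  refine and_congr toLp_mem_eigenspace_toEuclideanLin_iff.symm ?_
  rw [dotProduct_comm]
  rfl

end EigenspaceOf

section ExistenceOfAdaptedDecompositions

variable {n : ℕ} {A : Matrix (Fin n) (Fin n) ℝ} {d x : Fin n → ℝ} {S : Finset (Fin n)}

theorem exists_bijOn_mainEigenvalues
    (hcard : ∀ μ, Finset.card {i | d i = μ} = Module.finrank ℝ (eigenspaceOf A μ))
    (x : Fin n → ℝ) : ∃ S : Finset (Fin n), Set.BijOn d S (mainEigenvalues A x) := by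
  have hsurj : Set.SurjOn d Set.univ (mainEigenvalues A x) := by
    rintro μ ⟨v, hv, hxv⟩
    have hbot : eigenspaceOf A μ ≠ ⊥ :=
      (Submodule.ne_bot_iff _).mpr ⟨v, hv, fun h0 => hxv (by rw [h0, dotProduct_zero])⟩
    have hne : Finset.card {i | d i = μ} ≠ 0 := by
      rwa [hcard, Submodule.finrank_eq_zero.ne]
    obtain ⟨i, hi⟩ := Finset.card_ne_zero.mp hne
    exact ⟨i, Set.mem_univ i, (Finset.mem_filter_univ i).mp hi⟩
  obtain ⟨s, -, hs⟩ := hsurj.exists_bijOn_subset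
  exact ⟨s.toFinite.toFinset, by rwa [Set.Finite.coe_toFinset]⟩

theorem exists_isAdaptedDecomposition (hA : A.IsSymm) (hd : Antitone d)
    (hcard : ∀ μ, Finset.card {i | d i = μ} = Module.finrank ℝ (eigenspaceOf A μ))
    (hS : Set.BijOn d S (mainEigenvalues A x)) : ∃ P, IsAdaptedDecomposition A x d P S := by
  have hT := isSymmetric_toEuclideanLin_iff.mpr (isHermitian_iff_isSymm.mpr hA)
  have hcardS : S.card = (mainEigenvalues A x).ncard := by
    rw [← hS.image_eq, hS.injOn.ncard_image, Set.ncard_coe_finset]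
  simp only [← finrank_eigenspace_toEuclideanLin] at hcard
  rw [mainEigenvalues_eq_inner_ne_zero] at hS
  obtain ⟨b, hb, hbS⟩ := exists_orthonormalBasis_eigenspace_inner_ne_zero_iff hT hcard hS
  let P := (EuclideanSpace.basisFun (Fin n) ℝ).toBasis.toMatrix b
  have hinner (i : Fin n) : x ⬝ᵥ P.col i = inner ℝ (WithLp.toLp 2 x) (b i) := dotProduct_comm _ _
  have hP : P ∈ orthogonalGroup (Fin n) ℝ :=
    (EuclideanSpace.basisFun (Fin n) ℝ).toMatrix_orthonormalBasis_mem_orthogonal b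
  have hAP : A * P = P * diagonal d := by
    ext j i
    rw [mul_diagonal, mul_comm]
    exact congrFun (mem_eigenspaceOf_iff.mp
      (toLp_mem_eigenspace_toEuclideanLin_iff.mp (hb i))) j
  refine ⟨P, hd, hP, ?_, hcardS, fun i hi => ?_, fun i hi => ?_⟩
  · rw [← hAP, mul_assoc, (mem_orthogonalGroup_iff _ _).mp hP, mul_one]
  · rw [hinner]
    exact (hbS i).mpr hi
  · rw [hinner]
    exact not_not.mp (mt (hbS i).mp hi)

end ExistenceOfAdaptedDecompositions

namespace IsAdaptedDecomposition

variable {n : ℕ} {A B : Matrix (Fin n) (Fin n) ℝ} {x d : Fin n → ℝ}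
  {P U : Matrix (Fin n) (Fin n) ℝ} {S : Finset (Fin n)} {i : Fin n}

theorem isSymm (h : IsAdaptedDecomposition A x d P S) : A.IsSymm := by
  rw [h.eq_mul, IsSymm, transpose_mul, transpose_mul, transpose_transpose, diagonal_transpose,
    mul_assoc]

theorem col_mem_eigenspaceOf (h : IsAdaptedDecomposition A x d P S) (i : Fin n) :
    P.col i ∈ eigenspaceOf A (d i) := by
  have hAP : A * P = P * diagonal d := by
    rw [h.eq_mul, mul_assoc, (mem_orthogonalGroup_iff' _ _).mp h.orthogonal, mul_one]
  rw [mem_eigenspaceOf_iff]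
  ext j
  rw [Pi.smul_apply, smul_eq_mul, mul_comm]
  exact (congrFun₂ hAP j i).trans (mul_diagonal _ _ _ _)

theorem sum_dotProduct_smul_col (h : IsAdaptedDecomposition A x d P S) (v : Fin n → ℝ) :
    ∑ i, (v ⬝ᵥ P.col i) • P.col i = v := by
  have hv : P *ᵥ (Pᵀ *ᵥ v) = v := by
    rw [mulVec_mulVec, (mem_orthogonalGroup_iff _ _).mp h.orthogonal, one_mulVec]
  nth_rewrite 2 [← hv]
  rw [mulVec_eq_sum]
  simp only [op_smul_eq_smul, mulVec_transpose]
  rfl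

theorem dotProduct_col_eq_zero (h : IsAdaptedDecomposition A x d P S) {μ : ℝ} {v : Fin n → ℝ}
    (hv : v ∈ eigenspaceOf A μ) (hi : d i ≠ μ) : v ⬝ᵥ P.col i = 0 := by
  have hsymm : v ⬝ᵥ A *ᵥ P.col i = A *ᵥ v ⬝ᵥ P.col i := by
    rw [dotProduct_mulVec, ← mulVec_transpose, h.isSymm]
  rw [mem_eigenspaceOf_iff.mp (h.col_mem_eigenspaceOf i), mem_eigenspaceOf_iff.mp hv,
    dotProduct_smul, smul_dotProduct] at hsymm
  exact (mul_eq_mul_right_iff.mp hsymm).resolve_left hi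

theorem mainEigenvalues_eq (h : IsAdaptedDecomposition A x d P S) :
    mainEigenvalues A x = d '' S := by
  refine subset_antisymm ?_ ?_
  · rintro μ ⟨v, hv, hxv⟩
    rw [← h.sum_dotProduct_smul_col v, dotProduct_sum] at hxv
    obtain ⟨i, -, hi⟩ := Finset.exists_ne_zero_of_sum_ne_zero hxv
    rw [dotProduct_smul, smul_ne_zero_iff] at hi
    exact ⟨i, not_imp_comm.mp (h.not_mem i) hi.2,
      not_imp_comm.mp (h.dotProduct_col_eq_zero hv) hi.1⟩
  · rintro _ ⟨i, hi, rfl⟩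
    exact ⟨P.col i, h.col_mem_eigenspaceOf i, h.mem i hi⟩

theorem injOn (h : IsAdaptedDecomposition A x d P S) : Set.InjOn d S := by
  have hcard := h.card_eq
  rw [h.mainEigenvalues_eq, ← Finset.coe_image, Set.ncard_coe_finset] at hcard
  exact Finset.card_image_iff.mp hcard.symm

theorem aeval_mulVec (h : IsAdaptedDecomposition A x d P S) (q : ℝ[X]) :
    aeval A q *ᵥ x = ∑ i, (x ⬝ᵥ P.col i * q.eval (d i)) • P.col i := by
  nth_rewrite 1 [← h.sum_dotProduct_smul_col x]
  rw [mulVec_sum]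
  exact Finset.sum_congr rfl fun i _ => by
    rw [mulVec_smul, aeval_mulVec_of_mem_eigenspaceOf (h.col_mem_eigenspaceOf i), smul_smul]

theorem aeval_basis_mulVec (h : IsAdaptedDecomposition A x d P S) (hi : i ∈ S) :
    aeval A (Lagrange.basis S d i) *ᵥ x = (x ⬝ᵥ P.col i) • P.col i := by
  rw [h.aeval_mulVec, Fintype.sum_eq_single i, Lagrange.eval_basis_self h.injOn hi, mul_one]
  intro j hj
  by_cases hjS : j ∈ S
  · rw [Lagrange.eval_basis_of_ne hj.symm hjS, mul_zero, zero_smul]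
  · rw [h.not_mem j hjS, zero_mul, zero_smul]

theorem col_eq_or_eq_neg (hA : IsAdaptedDecomposition A x d P S)
    (hB : IsAdaptedDecomposition B x d U S) (hAB : ∀ q : ℝ[X], aeval A q *ᵥ x = aeval B q *ᵥ x)
    (hi : i ∈ S) : P.col i = U.col i ∨ P.col i = -U.col i := by
  have hproj : (x ⬝ᵥ P.col i) • P.col i = (x ⬝ᵥ U.col i) • U.col i := by
    rw [← hA.aeval_basis_mulVec hi, ← hB.aeval_basis_mulVec hi, hAB]
  have hsq : (x ⬝ᵥ P.col i) ^ 2 = (x ⬝ᵥ U.col i) ^ 2 := by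
    simpa only [dotProduct_smul, smul_eq_mul, ← pow_two] using congrArg (x ⬝ᵥ ·) hproj
  refine (sq_eq_sq_iff_eq_or_eq_neg.mp hsq).imp (fun heq => ?_) fun hneg => ?_
  · rw [← heq] at hproj
    exact smul_right_injective _ (hA.mem i hi) hproj
  · rw [← neg_eq_iff_eq_neg.mpr hneg, neg_smul, ← smul_neg] at hproj
    exact smul_right_injective _ (hA.mem i hi) hproj

theorem col_mem_eigenspaceOf_of_aeval_mulVec_eq (h : IsAdaptedDecomposition A x d P S)
    (hAB : ∀ q : ℝ[X], aeval A q *ᵥ x = aeval B q *ᵥ x) (hi : i ∈ S) :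
    P.col i ∈ eigenspaceOf B (d i) := by
  have hmul (M : Matrix (Fin n) (Fin n) ℝ) (q : ℝ[X]) :
      aeval M (X * q) *ᵥ x = M *ᵥ aeval M q *ᵥ x := by
    rw [map_mul, aeval_X, ← mulVec_mulVec]
  have hmem : (x ⬝ᵥ P.col i) • P.col i ∈ eigenspaceOf B (d i) := by
    rw [mem_eigenspaceOf_iff, ← h.aeval_basis_mulVec hi, hAB, ← hmul, ← hAB, ← hAB,
      hmul, h.aeval_basis_mulVec hi]
    exact mem_eigenspaceOf_iff.mp (Submodule.smul_mem _ _ (h.col_mem_eigenspaceOf i))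
  exact (Submodule.smul_mem_iff _ (h.mem i hi)).mp hmem

theorem eigenspaceOf_eq_of_finrank_eq_one (h : IsAdaptedDecomposition A x d P S) (hB : B.IsSymm)
    (hcharpoly : A.charpoly = B.charpoly) (hAB : ∀ q : ℝ[X], aeval A q *ᵥ x = aeval B q *ᵥ x)
    {μ : ℝ} (hμ : Module.finrank ℝ (eigenspaceOf A μ) = 1) (hmain : μ ∈ mainEigenvalues A x) :
    eigenspaceOf A μ = eigenspaceOf B μ := by
  rw [h.mainEigenvalues_eq] at hmain
  obtain ⟨i, hi, rfl⟩ := hmain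
  have hμB : Module.finrank ℝ (eigenspaceOf B (d i)) = 1 := by
    rw [← hμ, finrank_eigenspaceOf hB, finrank_eigenspaceOf h.isSymm, hcharpoly]
  have hcol : P.col i ≠ 0 := fun h0 => h.mem i hi (by rw [h0, dotProduct_zero])
  by_contra hne
  exact hcol (Submodule.disjoint_def.mp
    ((Submodule.isAtom_iff_finrank_eq_one.mpr hμ).disjoint_of_ne
      (Submodule.isAtom_iff_finrank_eq_one.mpr hμB) hne) _ (h.col_mem_eigenspaceOf i)
    (h.col_mem_eigenspaceOf_of_aeval_mulVec_eq hAB hi))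

end IsAdaptedDecomposition

section PolynomialsAgreeingOnVector

variable {n : ℕ} {A B : Matrix (Fin n) (Fin n) ℝ} {x : Fin n → ℝ}

theorem mainEigenvalues_subset_of_aeval_mulVec_eq (hA : A.IsSymm)
    (hAB : ∀ q : ℝ[X], aeval A q *ᵥ x = aeval B q *ᵥ x) :
    mainEigenvalues A x ⊆ mainEigenvalues B x := by
  obtain ⟨d, hd, hcard⟩ := exists_antitone_card_eq_finrank_eigenspaceOf hA
  obtain ⟨S, hS⟩ := exists_bijOn_mainEigenvalues hcard x
  obtain ⟨P, hP⟩ := exists_isAdaptedDecomposition hA hd hcard hS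
  rw [hP.mainEigenvalues_eq]
  rintro _ ⟨i, hi, rfl⟩
  exact ⟨P.col i, hP.col_mem_eigenspaceOf_of_aeval_mulVec_eq hAB hi, hP.mem i hi⟩

theorem mainEigenvalues_eq_of_aeval_mulVec_eq (hA : A.IsSymm) (hB : B.IsSymm)
    (hAB : ∀ q : ℝ[X], aeval A q *ᵥ x = aeval B q *ᵥ x) :
    mainEigenvalues A x = mainEigenvalues B x :=
  (mainEigenvalues_subset_of_aeval_mulVec_eq hA hAB).antisymm
    (mainEigenvalues_subset_of_aeval_mulVec_eq hB fun q => (hAB q).symm)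

theorem exists_common_isAdaptedDecomposition (hA : A.IsSymm) (hB : B.IsSymm)
    (hcharpoly : A.charpoly = B.charpoly) (hmain : mainEigenvalues A x = mainEigenvalues B x) :
    ∃ S d P U, IsAdaptedDecomposition A x d P S ∧ IsAdaptedDecomposition B x d U S := by
  obtain ⟨d, hd, hcard⟩ := exists_antitone_card_eq_finrank_eigenspaceOf hA
  obtain ⟨S, hS⟩ := exists_bijOn_mainEigenvalues hcard x
  obtain ⟨P, hP⟩ := exists_isAdaptedDecomposition hA hd hcard hS
  simp only [finrank_eigenspaceOf hA, hcharpoly, ← finrank_eigenspaceOf hB] at hcard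
  obtain ⟨U, hU⟩ := exists_isAdaptedDecomposition hB hd hcard (hmain ▸ hS)
  exact ⟨S, d, P, U, hP, hU⟩

end PolynomialsAgreeingOnVector

theorem mainTheorem4 (n : ℕ) (hn : 3 ≤ n) (A B : Matrix (Fin n) (Fin n) ℝ)
    (hA : A.IsSymm) (hB : B.IsSymm) (hAB : Hypomorphic A B) :
    (∃ (S : Finset (Fin n)) (d : Fin n → ℝ) (P U : Matrix (Fin n) (Fin n) ℝ),
      IsAdaptedDecomposition A 1 d P S ∧ IsAdaptedDecomposition B 1 d U S ∧
      ∀ i ∈ S, P.col i = U.col i ∨ P.col i = -U.col i) ∧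
    (∀ (S : Finset (Fin n)) (d : Fin n → ℝ) (P U : Matrix (Fin n) (Fin n) ℝ),
      IsAdaptedDecomposition A 1 d P S → IsAdaptedDecomposition B 1 d U S →
      ∀ i ∈ S, P.col i = U.col i ∨ P.col i = -U.col i) ∧
    (∀ μ : ℝ, Module.finrank ℝ (eigenspaceOf A μ) = 1 →
      (∃ v ∈ eigenspaceOf A μ, (1 : Fin n → ℝ) ⬝ᵥ v ≠ 0) →
      eigenspaceOf A μ = eigenspaceOf B μ) := by
  have hcharpoly := hAB.charpoly_eq hn hA hB
  have haeval := hAB.aeval_mulVec_one_eq hn hA hB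
  obtain ⟨S, d, P, U, hP, hU⟩ := exists_common_isAdaptedDecomposition hA hB hcharpoly
    (mainEigenvalues_eq_of_aeval_mulVec_eq hA hB haeval)
  exact ⟨⟨S, d, P, U, hP, hU, fun i hi => hP.col_eq_or_eq_neg hU haeval hi⟩,
    fun S d P U hP hU i hi => hP.col_eq_or_eq_neg hU haeval hi,
    fun μ hμ hmain =>
      hP.eigenspaceOf_eq_of_finrank_eq_one hB hcharpoly haeval hμ hmain⟩
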